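/- Let $n\ge 1$. For $1\le k\le n$ and $l\ge 0$ let $B^{(k)}_l$ be the set of semistandard tableaux of rectangular shape $(l^k)$ with letters in $\{1,\dots,n+1\}$ (the Kirillov–Reshetikhin crystal of type $A^{(1)}_n$). For $b\in B^{(k)}_l$ put $\mathrm{wt}(b)=\sum_{a=1}^n (m_a(b)-m_{a+1}(b))\varpi_a$, where $m_j(b)$ is the number of letters $j$ in $b$, and $e^{\mathrm{wt}(b)}=\prod_{a=1}^n z_a^{m_a(b)-m_{a+1}(b)}$ with real parameters $z_1,\dots,z_n>0$. Let $Q^{(k)}_l=\sum_{b\in B^{(k)}_l}e^{\mathrm{wt}(b)}$. On a tensor product (as a set, the Cartesian product) weights add up. For tableaux $S,T$ let $S\cdot T$ be the tableau product, obtained by row-inserting into $S$ the letters of the row word of $T$ (rows read from bottom to top, each from left to right). The combinatorial $R$ is the bijection $R:B^{(a)}_i\otimes B^{(r)}_s\to B^{(r)}_s\otimes B^{(a)}_i$ such that $R(b\otimes c)=\tilde c\otimes\tilde b$ if and only if $c\cdot b=\tilde b\cdot\tilde c$. The local energy $H(b\otimes c)$ is the number of nodes strictly below the $\max(a,r)$-th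 row of $c\cdot b$. Let $L\ge 0$, let $(k_i,l_i)$ be such pairs for $1\le i\le L$, and write $B_i=B^{(k_i)}_{l_i}$, $Q_i=Q^{(k_i)}_{l_i}$. For $b_1\otimes\cdots\otimes b_L\in B_1\otimes\cdots\otimes B_L$ and $i<j$ let $b^{(i+1)}_j\in B_j$ be the element that arrives at position $i+1$ when $b_j$ is sent to the left through $b_{j-1},\dots,b_{i+1}$ by successive application of the combinatorial $R$, that is, $b_j^{(j)}=b_j$ and $b_j^{(m)}$ is the first factor of $R(b_m\otimes b_j^{(m+1)})$ for $m<j$. Put $$D(b_1\otimes\cdots\otimes b_L)=\sum_{1\le i<j\le L}H(b_i\otimes b^{(i+1)}_j),\qquad \chi_w(B_1\otimes\cdots\otimes B_L)=\sum_{b\in B_1\otimes\cdots\otimes B_L}w^{D(b)}e^{\mathrm{wt}(b)}.$$ Then $$\frac{\partial}{\partial w}\log\chi_w(B_1\otimes\cdots\otimes B_L)\Big|_{w=1}=\sum_{1\le i<j\le L}\frac{1}{Q_iQ_j}\sum_{b\otimes c\in B_i\otimes B_j}H(b\otimes c)\,e^{\mathrm{wt}(b\otimes c)}.$$ In other words,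 with $Q_i\ast Q_j=\chi_w(B_i\otimes B_j)$, the left-hand side equals $\sum_{1\le i<j\le L}\frac{\partial}{\partial w}\log(Q_i\ast Q_j)\big|_{w=1}$. -/

import Mathlib

namespace KR

/-! ### Tableaux as lists of rows, row bumping, the tableau product

A tableau is handled as the list of its rows, from top to bottom. -/

/-- Row-insert the letter `x` into one row: `x` replaces the leftmost entry that is strictly
larger than `x`, and this entry is bumped out; if there is none, `x` is put at the end of the
row and nothing is bumped out. -/
def insertRow (x : ℕ) : List ℕ → List ℕ × Option ℕ
  | [] => ([x], none)
  | y :: ys => if x < y then (x :: ys, some y) else (y :: (insertRow x ys).1, (insertRow x ys).2)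

/-- The row bumping algorithm `S ← x`. -/
def bump : List (List ℕ) → ℕ → List (List ℕ)
  | [], x => [[x]]
  | r :: rs, x =>
    match (insertRow x r).2 with
    | none => (insertRow x r).1 :: rs
    | some y => (insertRow x r).1 :: bump rs y

/-- The rows of a semistandard tableau, from top to bottom. -/
def rows {μ : YoungDiagram} (T : SemistandardYoungTableau μ) : List (List ℕ) :=
  (List.range (μ.colLen 0)).map fun i => (List.range (μ.rowLen i)).map fun j => T i j

/-- The row word: the letters read from the bottom row to the top row, from left to right in
each row. -/
def rowWord {μ : YoungDiagram} (T : SemistandardYoungTableau μ) : List ℕ :=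
  (rows T).reverse.flatten

/-- The tableau product `S · T = (⋯((S ← u₁) ← u₂)⋯) ← u_l`, where `u₁ u₂ … u_l` is the row
word of `T`. -/
def tableauProd {μ ν : YoungDiagram} (S : SemistandardYoungTableau μ)
    (T : SemistandardYoungTableau ν) : List (List ℕ) :=
  (rowWord T).foldl bump (rows S)

/-! ### Kirillov-Reshetikhin crystals of type `A_n^{(1)}` -/

/-- The rectangle with `k` rows and `l` columns. -/
def rect (k l : ℕ) : YoungDiagram where
  cells := Finset.range k ×ˢ Finset.range l
  isLowerSet := by
    intro p q hqp hp
    simp only [Finset.coe_product, Finset.coe_range, Set.mem_prod, Set.mem_Iio] at hp ⊢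
    exact ⟨lt_of_le_of_lt hqp.1 hp.1, lt_of_le_of_lt hqp.2 hp.2⟩

/-- The crystal `B^{(k)}_l` as a set: the semistandard tableaux of rectangular shape `(l^k)`
with letters from `{1, …, n+1}`. -/
def Crystal (n k l : ℕ) : Type :=
  {T : SemistandardYoungTableau (rect k l) // ∀ p ∈ rect k l, 1 ≤ T p.1 p.2 ∧ T p.1 p.2 ≤ n + 1}

instance (n k l : ℕ) : Finite (Crystal n k l) := by
  refine Finite.of_injective
    (fun (T : Crystal n k l) (p : Fin k × Fin l) =>
      (⟨T.1 p.1 p.2, Nat.lt_succ_of_le (T.2 (p.1, p.2) (by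
        simp [rect, ← YoungDiagram.mem_cells])).2⟩ : Fin (n + 2))) ?_
  intro S T h
  apply Subtype.ext
  ext i j
  by_cases hij : (i, j) ∈ rect k l
  · have hij' : i < k ∧ j < l := by simpa [rect, ← YoungDiagram.mem_cells] using hij
    simpa using congrFun h (⟨i, hij'.1⟩, ⟨j, hij'.2⟩)
  · rw [S.1.zeros hij, T.1.zeros hij]

noncomputable instance (n k l : ℕ) : Fintype (Crystal n k l) := Fintype.ofFinite _

/-- The weight of a tableau in the basis of the fundamental weights: the coefficient of `ϖ_a`
(`1 ≤ a ≤ n`, stored at the index `a - 1`) is the number of letters `a` minus the number of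
letters `a + 1`. -/
def wt {n k l : ℕ} (b : Crystal n k l) : Fin n → ℤ := fun a =>
  ((rowWord b.1).count (a.val + 1) : ℤ) - ((rowWord b.1).count (a.val + 2) : ℤ)

/-- `e^μ = ∏_a z_a^{μ_a}` for `μ = ∑_a μ_a ϖ_a`, where `z_a = e^{ϖ_a}`. -/
noncomputable def expWt {n : ℕ} (z : Fin n → ℝ) (μ : Fin n → ℤ) : ℝ := ∏ a, z a ^ μ a

/-- The classical character `Q^{(k)}_l = ∑_{b ∈ B^{(k)}_l} e^{wt(b)}`. -/
noncomputable def Q {n : ℕ} (z : Fin n → ℝ) (k l : ℕ) : ℝ :=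
  ∑ b : Crystal n k l, expWt z (wt b)

/-! ### Combinatorial `R` and local energy -/

/-- The local energy `H(b ⊗ c)` on `B^{(a)}_i ⊗ B^{(r)}_s`: the number of nodes strictly below
the `max(a, r)`-th row of the tableau `c · b`. -/
def H {n a i r s : ℕ} (b : Crystal n a i) (c : Crystal n r s) : ℕ :=
  (((tableauProd c.1 b.1).drop (max a r)).map List.length).sum

/-- The property that determines the combinatorial `R`: for all `b, c, c', b'`,
`R (b ⊗ c) = c' ⊗ b'` is equivalent to `c · b = b' · c'`. -/
def IsCombinatorialR {n a i r s : ℕ}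
    (R : Crystal n a i × Crystal n r s ≃ Crystal n r s × Crystal n a i) : Prop :=
  ∀ (b : Crystal n a i) (c : Crystal n r s) (c' : Crystal n r s) (b' : Crystal n a i),
    R (b, c) = (c', b') ↔ tableauProd c.1 b.1 = tableauProd b'.1 c'.1

open Classical in
/-- The combinatorial `R : B^{(a)}_i ⊗ B^{(r)}_s → B^{(r)}_s ⊗ B^{(a)}_i`: the bijection with
the property `IsCombinatorialR`. There is at most one by the form of the property, and there is
one because products of two rectangular Schur functions are multiplicity free, so that the
`else` branch only makes the definition total. -/
noncomputable def combR (n a i r s : ℕ) :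
    Crystal n a i × Crystal n r s ≃ Crystal n r s × Crystal n a i :=
  if h : ∃ R : Crystal n a i × Crystal n r s ≃ Crystal n r s × Crystal n a i,
      IsCombinatorialR R
  then h.choose
  else Equiv.prodComm _ _

/-! ### Tensor products `B^{(k_1)}_{l_1} ⊗ ⋯ ⊗ B^{(k_L)}_{l_L}`

The positions `1, …, L` are the elements of `Fin L`. -/

/-- The underlying set of `B^{(k_1)}_{l_1} ⊗ ⋯ ⊗ B^{(k_L)}_{l_L}`. -/
abbrev Tensor (n : ℕ) {L : ℕ} (k l : Fin L → ℕ) : Type := (i : Fin L) → Crystal n (k i) (l i)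

/-- The element that reaches the position just to the right of `i` when `b_j` (`i < j`) is sent
to the left through `b_{j-1}, …, b_{i+1}` by successive application of the combinatorial `R`;
this is `b_j^{(i+1)}`. Passing `b_m` replaces `x` by the first factor of `R (b_m ⊗ x)`. -/
noncomputable def sendLeft {n L : ℕ} {k l : Fin L → ℕ} (b : Tensor n k l) (i j : Fin L) :
    Crystal n (k j) (l j) :=
  ((List.finRange L).filter fun m => i < m ∧ m < j).foldr
    (fun m x => (combR n (k m) (l m) (k j) (l j) (b m, x)).1) (b j)

/-- The energy `D(b_1 ⊗ ⋯ ⊗ b_L) = ∑_{i < j} H(b_i ⊗ b_j^{(i+1)})`. -/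
noncomputable def D {n L : ℕ} {k l : Fin L → ℕ} (b : Tensor n k l) : ℕ :=
  ∑ i, ∑ j ∈ Finset.Ioi i, H (b i) (sendLeft b i j)

/-- The deformed character `χ_w(B) = ∑_{b ∈ B} w^{D(b)} e^{wt(b)}` of
`B = B^{(k_1)}_{l_1} ⊗ ⋯ ⊗ B^{(k_L)}_{l_L}`, where `wt(b_1 ⊗ ⋯ ⊗ b_L) = ∑_i wt(b_i)`. -/
noncomputable def chi {n L : ℕ} (z : Fin n → ℝ) (k l : Fin L → ℕ) (w : ℝ) : ℝ :=
  ∑ b : Tensor n k l, w ^ D b * expWt z (∑ i, wt (b i))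

end KR

namespace KR

/-! ### Content of the tableau product -/

/-! At `w = 1` the logarithmic derivative is the mean of `D` under the weights `expWt`, and
`chi_one` gives the normalisation `∏ Q`. By linearity it suffices to average each `H (b i) (sendLeft
b i j)` separately. Carrying `b j` leftwards through the factors strictly between `i` and `j`
extends to a bijection of the tensor product that keeps `b i` and the total weight, so `sendLeft b i
j` may be replaced by `b j` (`sum_sendLeft`). The weight is multiplicative, so every factor other
than `i` and `j` sums to its own `Q` and cancels (`sum_pi_pair_mul_prod`).

Of the combinatorial `R`, only bijectivity and weight preservation (`wt_combR`) enter; the latter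
holds because row insertion preserves the multiset of letters. -/

lemma insertRow_perm (x : ℕ) (r : List ℕ) :
    ((insertRow x r).1 ++ (insertRow x r).2.toList).Perm (x :: r) := by
  induction r with
  | nil => simp [insertRow]
  | cons y ys ih =>
    by_cases h : x < y
    · simp [insertRow, h]
    · simp only [insertRow, h, if_false, List.cons_append]
      exact (ih.cons y).trans (List.Perm.swap x y ys)

lemma flatten_bump_perm (S : List (List ℕ)) (x : ℕ) :
    (bump S x).flatten.Perm (x :: S.flatten) := by
  induction S generalizing x with
  | nil => simp [bump]
  | cons r rs ih =>
    have h := insertRow_perm x r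
    unfold bump
    split
    · next hn =>
      rw [hn] at h
      simpa using h.append_right rs.flatten
    · next y hy =>
      rw [hy] at h
      simp only [List.flatten_cons]
      refine ((ih y).append_left _).trans ?_
      simpa using h.append_right rs.flatten

lemma flatten_foldl_bump_perm (u : List ℕ) (S : List (List ℕ)) :
    (u.foldl bump S).flatten.Perm (u ++ S.flatten) := by
  induction u generalizing S with
  | nil => simp
  | cons x u ih =>
    refine (ih (bump S x)).trans (((flatten_bump_perm S x).append_left u).trans ?_)
    simp

lemma flatten_rows_perm {μ : YoungDiagram} (T : SemistandardYoungTableau μ) :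
    (rows T).flatten.Perm (rowWord T) :=
  ((List.reverse_perm (rows T)).flatten).symm

/-- The letters of `S · T` are those of `S` and `T`. -/
lemma count_flatten_tableauProd {μ ν : YoungDiagram} (S : SemistandardYoungTableau μ)
    (T : SemistandardYoungTableau ν) (a : ℕ) :
    (tableauProd S T).flatten.count a = (rowWord S).count a + (rowWord T).count a := by
  rw [tableauProd, (flatten_foldl_bump_perm _ _).count_eq, List.count_append,
    (flatten_rows_perm S).count_eq, add_comm]

lemma wt_add_eq_of_tableauProd_eq {n a i r s : ℕ} {b b' : Crystal n a i} {c c' : Crystal n r s}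
    (h : tableauProd c.1 b.1 = tableauProd b'.1 c'.1) : wt c' + wt b' = wt b + wt c := by
  funext t
  have h₁ := congrArg (fun S => S.flatten.count (t.val + 1)) h
  have h₂ := congrArg (fun S => S.flatten.count (t.val + 2)) h
  simp only [count_flatten_tableauProd] at h₁ h₂
  simp only [wt, Pi.add_apply]
  omega

/-- The combinatorial `R` preserves weights. -/
lemma wt_combR {n a i r s : ℕ} (p : Crystal n a i × Crystal n r s) :
    wt (combR n a i r s p).1 + wt (combR n a i r s p).2 = wt p.1 + wt p.2 := by
  unfold combR
  split_ifs with h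
  · exact wt_add_eq_of_tableauProd_eq ((h.choose_spec p.1 p.2 _ _).1 rfl)
  -- The default branch is the flip, which also preserves weight, so the existence of `R` need not
  -- be proved.
  · exact add_comm _ _

/-! ### The exponential of a weight and positivity of characters -/

lemma expWt_pos {n : ℕ} {z : Fin n → ℝ} (hz : ∀ a, 0 < z a) (μ : Fin n → ℤ) : 0 < expWt z μ :=
  Finset.prod_pos fun a _ => zpow_pos (hz a) _

lemma expWt_zero {n : ℕ} (z : Fin n → ℝ) : expWt z 0 = 1 := by simp [expWt]

lemma expWt_add {n : ℕ} {z : Fin n → ℝ} (hz : ∀ a, 0 < z a) (μ ν : Fin n → ℤ) :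
    expWt z (μ + ν) = expWt z μ * expWt z ν := by
  simp only [expWt, ← Finset.prod_mul_distrib, Pi.add_apply]
  exact Finset.prod_congr rfl fun a _ => zpow_add₀ (hz a).ne' _ _

lemma expWt_sum {n : ℕ} {z : Fin n → ℝ} (hz : ∀ a, 0 < z a) {ι : Type*} (s : Finset ι)
    (μ : ι → Fin n → ℤ) : expWt z (∑ i ∈ s, μ i) = ∏ i ∈ s, expWt z (μ i) := by
  classical
  induction s using Finset.induction_on with
  | empty => simp [expWt_zero]
  | insert i s hi ih => rw [Finset.sum_insert hi, Finset.prod_insert hi, expWt_add hz, ih]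

lemma mem_rect {k l i j : ℕ} : (i, j) ∈ rect k l ↔ i < k ∧ j < l := by
  simp [rect, ← YoungDiagram.mem_cells]

/-- The tableau whose `i`-th row consists of letters `i` is an element of `B^{(k)}_l`. -/
lemma crystal_nonempty {n k : ℕ} (l : ℕ) (hk : k ≤ n + 1) : Nonempty (Crystal n k l) := by
  refine ⟨⟨{ entry := fun i j => if (i, j) ∈ rect k l then i + 1 else 0
             row_weak' := ?_, col_strict' := ?_, zeros' := ?_ }, ?_⟩⟩
  · intro i j₁ j₂ hj h
    have h' : (i, j₁) ∈ rect k l := mem_rect.2 ⟨(mem_rect.1 h).1, hj.trans (mem_rect.1 h).2⟩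
    simp [h, h']
  · intro i₁ i₂ j hi h
    have h' : (i₁, j) ∈ rect k l := mem_rect.2 ⟨hi.trans (mem_rect.1 h).1, (mem_rect.1 h).2⟩
    simp [h, h', hi]
  · intro i j h
    simp [h]
  · rintro ⟨i, j⟩ h
    have := (mem_rect.1 h).1
    change 1 ≤ (if (i, j) ∈ rect k l then i + 1 else 0) ∧
      (if (i, j) ∈ rect k l then i + 1 else 0) ≤ n + 1
    rw [if_pos h]
    omega

lemma Q_pos {n k : ℕ} (l : ℕ) (hk : k ≤ n + 1) {z : Fin n → ℝ} (hz : ∀ a, 0 < z a) :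
    0 < Q z k l :=
  have := crystal_nonempty l hk
  Finset.sum_pos (fun _ _ => expWt_pos hz _) Finset.univ_nonempty

lemma chi_one {n L : ℕ} (k l : Fin L → ℕ) {z : Fin n → ℝ} (hz : ∀ a, 0 < z a) :
    chi z k l 1 = ∏ i, Q z (k i) (l i) := by
  simp only [chi, one_pow, one_mul, expWt_sum hz, Q]
  rw [Finset.prod_univ_sum, Fintype.piFinset_univ]

/-! ### Moving one factor to the left -/

/-- Interchange the factors at the positions `m` and `j` by the combinatorial `R`, without
moving the positions that belong to the two crystals. -/
noncomputable def exchange {n L : ℕ} {k l : Fin L → ℕ} (j m : Fin L) (b : Tensor n k l) :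
    Tensor n k l :=
  Function.update
    (Function.update b j (combR n (k m) (l m) (k j) (l j) (b m, b j)).1)
    m (combR n (k m) (l m) (k j) (l j) (b m, b j)).2

section exchange

variable {n L : ℕ} {k l : Fin L → ℕ} {j m : Fin L}

lemma exchange_left (b : Tensor n k l) :
    exchange j m b m = (combR n (k m) (l m) (k j) (l j) (b m, b j)).2 := by
  simp [exchange]

lemma exchange_right (h : m ≠ j) (b : Tensor n k l) :
    exchange j m b j = (combR n (k m) (l m) (k j) (l j) (b m, b j)).1 := by
  simp [exchange, h.symm]

lemma exchange_of_ne {p : Fin L} (hm : p ≠ m) (hj : p ≠ j) (b : Tensor n k l) :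
    exchange j m b p = b p := by
  simp [exchange, hm, hj]

/-- The entries at `j` and `m` together form the value of `R`, so injectivity of `R` recovers the
original pair. -/
lemma exchange_injective (h : m ≠ j) :
    Function.Injective (exchange (n := n) (k := k) (l := l) j m) := by
  intro b c hbc
  have hR : combR n (k m) (l m) (k j) (l j) (b m, b j) =
      combR n (k m) (l m) (k j) (l j) (c m, c j) := by
    refine Prod.ext ?_ ?_
    · rw [← exchange_right h, ← exchange_right h, hbc]
    · rw [← exchange_left, ← exchange_left, hbc]
  obtain ⟨hm, hj⟩ := Prod.mk.inj ((combR n (k m) (l m) (k j) (l j)).injective hR)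
  funext p
  rcases eq_or_ne p m with rfl | hpm
  · exact hm
  rcases eq_or_ne p j with rfl | hpj
  · exact hj
  rw [← exchange_of_ne hpm hpj b, hbc, exchange_of_ne hpm hpj]

lemma sum_wt_exchange (h : m ≠ j) (b : Tensor n k l) :
    ∑ p, wt (exchange j m b p) = ∑ p, wt (b p) := by
  rw [← Finset.sum_add_sum_compl {m, j}, ← Finset.sum_add_sum_compl {m, j} fun p => wt (b p),
    Finset.sum_pair h, Finset.sum_pair h, exchange_left, exchange_right h, add_comm (wt _),
    wt_combR]
  congr 1
  refine Finset.sum_congr rfl fun p hp => ?_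
  simp only [Finset.mem_compl, Finset.mem_insert, Finset.mem_singleton, not_or] at hp
  rw [exchange_of_ne hp.1 hp.2]

/-- Exchange the factor at `j` with those at the positions in `ms`, from right to left. -/
noncomputable def exchangeList (j : Fin L) (ms : List (Fin L)) (b : Tensor n k l) :
    Tensor n k l :=
  ms.foldr (exchange j) b

variable {ms : List (Fin L)}

lemma exchangeList_injective (h : j ∉ ms) :
    Function.Injective (exchangeList (n := n) (k := k) (l := l) j ms) := by
  induction ms with
  | nil => exact fun _ _ h => h
  | cons m ms ih =>
    rw [List.mem_cons, not_or] at h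
    exact (exchange_injective (Ne.symm h.1)).comp (ih h.2)

lemma sum_wt_exchangeList (h : j ∉ ms) (b : Tensor n k l) :
    ∑ p, wt (exchangeList j ms b p) = ∑ p, wt (b p) := by
  induction ms with
  | nil => rfl
  | cons m ms ih =>
    rw [List.mem_cons, not_or] at h
    exact (sum_wt_exchange (Ne.symm h.1) _).trans (ih h.2)

lemma exchangeList_of_notMem {p : Fin L} (hp : p ∉ ms) (hj : p ≠ j) (b : Tensor n k l) :
    exchangeList j ms b p = b p := by
  induction ms with
  | nil => rfl
  | cons m ms ih =>
    rw [List.mem_cons, not_or] at hp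
    exact (exchange_of_ne hp.1 hj _).trans (ih hp.2)

/-- The travelling element is stored at index `j` throughout. Without repetitions in `ms`, it meets
each `b m` still unaltered, exactly as in `sendLeft`. -/
lemma exchangeList_apply_self (h : j ∉ ms) (hms : ms.Nodup) (b : Tensor n k l) :
    exchangeList j ms b j =
      ms.foldr (fun m x => (combR n (k m) (l m) (k j) (l j) (b m, x)).1) (b j) := by
  induction ms with
  | nil => rfl
  | cons m ms ih =>
    rw [List.mem_cons, not_or] at h
    rw [List.nodup_cons] at hms
    refine (exchange_right (Ne.symm h.1) (exchangeList j ms b)).trans ?_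
    rw [ih h.2 hms.2, exchangeList_of_notMem hms.1 (Ne.symm h.1)]
    rfl

end exchange

/-- Summed with the weights, the pair `(b_i, b_j^{(i+1)})` may be replaced by `(b_i, b_j)`. -/
lemma sum_sendLeft {n L : ℕ} {k l : Fin L → ℕ} (z : Fin n → ℝ) {i j : Fin L} (hij : i < j)
    (f : Crystal n (k i) (l i) → Crystal n (k j) (l j) → ℝ) :
    ∑ b : Tensor n k l, f (b i) (sendLeft b i j) * expWt z (∑ p, wt (b p)) =
      ∑ b : Tensor n k l, f (b i) (b j) * expWt z (∑ p, wt (b p)) := by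
  have hj : j ∉ (List.finRange L).filter fun m => i < m ∧ m < j := by simp
  have hi : i ∉ (List.finRange L).filter fun m => i < m ∧ m < j := by simp
  -- An injective self-map of a finite set is bijective, so no inverse is constructed.
  refine Fintype.sum_bijective (exchangeList j _)
    (Finite.injective_iff_bijective.1 (exchangeList_injective hj)) _ _ fun b => ?_
  rw [sum_wt_exchangeList hj, exchangeList_of_notMem hi hij.ne,
    exchangeList_apply_self hj ((List.nodup_finRange L).filter _)]
  rfl

/-! ### Sums over a product of finite types -/

/-- Fixing the values at `i` and `j` turns the sum into one of pure products, to which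
distributivity applies. -/
lemma sum_pi_pair_mul_prod {ι : Type*} [Fintype ι] [DecidableEq ι] {α : ι → Type*}
    [∀ m, Fintype (α m)] (e : ∀ m, α m → ℝ) {i j : ι} (hij : i ≠ j) (f : α i → α j → ℝ) :
    ∑ b : ∀ m, α m, f (b i) (b j) * ∏ m, e m (b m) =
      (∑ x, ∑ y, f x y * (e i x * e j y)) * ∏ m ∈ {i, j}ᶜ, ∑ t, e m t := by
  classical
  have key : ∀ x y, ∑ b : ∀ m, α m,
      (if b i = x ∧ b j = y then ∏ m, e m (b m) else 0) =
        e i x * e j y * ∏ m ∈ {i, j}ᶜ, ∑ t, e m t := by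
    intro x y
    -- The constraints `b i = x` and `b j = y` are absorbed into the factors at `i` and `j`, so the
    -- summand remains a product over all indices.
    let g : ∀ m, α m → ℝ := Function.update (Function.update e i (Pi.single x (e i x)))
      j (Pi.single y (e j y))
    have gi : g i = Pi.single x (e i x) := by simp [g, hij]
    have gj : g j = Pi.single y (e j y) := by simp [g]
    have gm : ∀ m ∈ ({i, j} : Finset ι)ᶜ, g m = e m := fun m hm => by
      simp only [Finset.mem_compl, Finset.mem_insert, Finset.mem_singleton, not_or] at hm
      simp [g, hm.1, hm.2]
    have hg : ∀ b : ∀ m, α m, (if b i = x ∧ b j = y then ∏ m, e m (b m) else 0) =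
        ∏ m, g m (b m) := fun b => by
      rw [← Finset.prod_mul_prod_compl {i, j}, ← Finset.prod_mul_prod_compl {i, j}
        fun m => g m (b m), Finset.prod_pair hij, Finset.prod_pair hij, gi, gj,
        Finset.prod_congr (f := fun m => g m (b m)) (g := fun m => e m (b m)) rfl
          fun m hm => by rw [gm m hm]]
      by_cases hx : b i = x <;> by_cases hy : b j = y <;> simp [hx, hy]
    simp only [hg]
    rw [← Fintype.piFinset_univ, ← Finset.prod_univ_sum, ← Finset.prod_mul_prod_compl {i, j},
      Finset.prod_pair hij, gi, gj,
      Finset.prod_congr (g := fun m => ∑ t, e m t) rfl fun m hm => by rw [gm m hm]]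
    simp
  have hf : ∀ b : ∀ m, α m, f (b i) (b j) * ∏ m, e m (b m) =
      ∑ x, ∑ y, f x y * (if b i = x ∧ b j = y then ∏ m, e m (b m) else 0) := fun b => by
    rw [Finset.sum_eq_single (b i), Finset.sum_eq_single (b j)]
    · simp
    · intro y _ hy
      simp [hy.symm]
    · simp
    · intro x _ hx
      simp [hx.symm]
    · simp
  simp only [hf]
  rw [Finset.sum_comm, Finset.sum_mul]
  refine Finset.sum_congr rfl fun x _ => ?_
  rw [Finset.sum_comm, Finset.sum_mul]
  refine Finset.sum_congr rfl fun y _ => ?_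
  rw [← Finset.mul_sum, key, ← mul_assoc]

/-! ### The logarithmic derivative -/

lemma hasDerivAt_chi {n L : ℕ} (z : Fin n → ℝ) (k l : Fin L → ℕ) :
    HasDerivAt (chi z k l) (∑ b : Tensor n k l, (D b : ℝ) * expWt z (∑ i, wt (b i))) 1 := by
  unfold chi
  refine HasDerivAt.fun_sum fun b _ => ?_
  simpa using (hasDerivAt_pow (D b) (1 : ℝ)).mul_const (expWt z (∑ i, wt (b i)))

lemma sum_energy_mul_expWt {n L : ℕ} (k l : Fin L → ℕ) {z : Fin n → ℝ} (hz : ∀ a, 0 < z a) :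
    ∑ b : Tensor n k l, (D b : ℝ) * expWt z (∑ i, wt (b i)) =
      ∑ i, ∑ j ∈ Finset.Ioi i, (∑ b : Crystal n (k i) (l i), ∑ c : Crystal n (k j) (l j),
        (H b c : ℝ) * expWt z (wt b + wt c)) * ∏ m ∈ {i, j}ᶜ, Q z (k m) (l m) := by
  simp only [D, Nat.cast_sum, Finset.sum_mul]
  rw [Finset.sum_comm]
  refine Finset.sum_congr rfl fun i _ => ?_
  rw [Finset.sum_comm]
  refine Finset.sum_congr rfl fun j hj => ?_
  have hij := Finset.mem_Ioi.1 hj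
  rw [sum_sendLeft z hij fun b c => (H b c : ℝ)]
  simp only [expWt_sum hz, expWt_add hz]
  rw [sum_pi_pair_mul_prod (fun m (b : Crystal n (k m) (l m)) => expWt z (wt b)) hij.ne
    fun b c => (H b c : ℝ), Finset.sum_mul]
  simp only [Finset.sum_mul]
  rfl

lemma hasDerivAt_log_chi {n L : ℕ} (k l : Fin L → ℕ) (hk : ∀ i, k i ≤ n + 1)
    {z : Fin n → ℝ} (hz : ∀ a, 0 < z a) :
    HasDerivAt (fun w : ℝ => Real.log (chi z k l w))
      (∑ i, ∑ j ∈ Finset.Ioi i, 1 / (Q z (k i) (l i) * Q z (k j) (l j)) *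
        ∑ b : Crystal n (k i) (l i), ∑ c : Crystal n (k j) (l j),
          (H b c : ℝ) * expWt z (wt b + wt c)) 1 := by
  have hQ : ∀ i, Q z (k i) (l i) ≠ 0 := fun i => (Q_pos (l i) (hk i) hz).ne'
  have h1 : chi z k l 1 ≠ 0 := by
    rw [chi_one k l hz]
    exact Finset.prod_ne_zero_iff.2 fun i _ => hQ i
  convert (hasDerivAt_chi z k l).log h1 using 1
  rw [sum_energy_mul_expWt k l hz, chi_one k l hz, Finset.sum_div]
  refine Finset.sum_congr rfl fun i _ => ?_
  rw [Finset.sum_div]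
  refine Finset.sum_congr rfl fun j hj => ?_
  have hc : ∏ m ∈ {i, j}ᶜ, Q z (k m) (l m) ≠ 0 := Finset.prod_ne_zero_iff.2 fun m _ => hQ m
  rw [← Finset.prod_mul_prod_compl {i, j}, Finset.prod_pair (Finset.mem_Ioi.1 hj).ne,
    mul_div_mul_right _ _ hc, one_div_mul_eq_div]

/-- The general formula with two factors has a single term; this identifies each summand with a
two-factor logarithmic derivative. -/
lemma hasDerivAt_log_chi_pair {n k₁ k₂ : ℕ} (l₁ l₂ : ℕ) (h₁ : k₁ ≤ n + 1) (h₂ : k₂ ≤ n + 1)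
    {z : Fin n → ℝ} (hz : ∀ a, 0 < z a) :
    HasDerivAt (fun w : ℝ => Real.log (chi z ![k₁, k₂] ![l₁, l₂] w))
      (1 / (Q z k₁ l₁ * Q z k₂ l₂) * ∑ b : Crystal n k₁ l₁, ∑ c : Crystal n k₂ l₂,
        (H b c : ℝ) * expWt z (wt b + wt c)) 1 := by
  have h := hasDerivAt_log_chi ![k₁, k₂] ![l₁, l₂] (n := n)
    (Fin.forall_fin_two.2 ⟨h₁, h₂⟩) hz
  have e₀ : Finset.Ioi (0 : Fin 2) = {1} := rfl
  have e₁ : Finset.Ioi (1 : Fin 2) = ∅ := rfl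
  rw [Fin.sum_univ_two, e₀, e₁, Finset.sum_singleton, Finset.sum_empty, add_zero] at h
  exact h

end KR

theorem lemma3p4 (n L : ℕ) (k l : Fin L → ℕ) (hk : ∀ i, 1 ≤ k i ∧ k i ≤ n)
    (z : Fin n → ℝ) (hz : ∀ a, 0 < z a) :
    HasDerivAt (fun w : ℝ => Real.log (KR.chi z k l w))
      (∑ i, ∑ j ∈ Finset.Ioi i, 1 / (KR.Q z (k i) (l i) * KR.Q z (k j) (l j)) *
        ∑ b : KR.Crystal n (k i) (l i), ∑ c : KR.Crystal n (k j) (l j),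
          (KR.H b c : ℝ) * KR.expWt z (KR.wt b + KR.wt c)) 1 ∧
    (∀ i j, i < j →
      DifferentiableAt ℝ (fun w : ℝ => Real.log (KR.chi z ![k i, k j] ![l i, l j] w)) 1) ∧
    HasDerivAt (fun w : ℝ => Real.log (KR.chi z k l w))
      (∑ i, ∑ j ∈ Finset.Ioi i,
        deriv (fun w : ℝ => Real.log (KR.chi z ![k i, k j] ![l i, l j] w)) 1) 1 := by
  have hk' : ∀ i, k i ≤ n + 1 := fun i => (hk i).2.trans n.le_succ
  have hpair := fun i j => KR.hasDerivAt_log_chi_pair (l i) (l j) (hk' i) (hk' j) hz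
  have hlog := KR.hasDerivAt_log_chi k l hk' hz
  refine ⟨hlog, fun i j _ => (hpair i j).differentiableAt, ?_⟩
  simp only [(hpair _ _).deriv]
  exact hlog
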